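/- Let $M,P\ge 0$ be integers, $F,G:\mathbb R^M\times\mathbb R^M\times\mathbb R^P\to\mathbb R^M$, $H:\mathbb R^M\times\mathbb R^M\times\mathbb R^P\to\mathbb R^P$, $r>0$, $x_0\in\mathbb R^M$, and $0<T,K<\infty$. Consider on $[0,T]$ the differential-algebraic equation $$\dot x=F(x,\mu,y),\qquad \dot\mu=r\mu-\mu\odot G(x,\mu,y),\qquad 0=H(x,\mu,y),\qquad x(0)=x_0, \tag{DAE}$$ where $\odot$ is the componentwise product and $x,\mu,y$ are differentiable on $[0,T]$. Assume that $F,G,H$ are Lipschitz with respect to $\|\cdot\|_\infty$, that $F,G$ have Lipschitz first derivatives, and that $H$ has Lipschitz first and second derivatives. Call a solution $(x,\mu,y)$ of (DAE) on $[0,T]$ *regular* if $\det\nabla_yH(x(t),\mu(t),y(t))\ne0$ for all $t\in[0,T]$ and $t\mapsto \nabla_yH(x(t),\mu(t),y(t))^{-1}$ is Lipschitz with a Lipschitz first derivative on $[0,T]$. Let $\mathbb S$ be the set of regular solutions of (DAE) with $\|\mu(0)\|_\infty\le K$ and $\|y(0)\|_\infty\le K$. Assume that $\mathbb S\neq\emptyset$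 and that every solution of (DAE) with $\|\mu(0)\|_\infty,\|y(0)\|_\infty\le K$ is regular. Let $\mathcal H$ be the reproducing kernel Hilbert space of functions on $[0,T]$ with the Matérn-$1/2$ kernel $k(s,t)=\sigma^2e^{-|s-t|/\ell}$, $\sigma,\ell>0$, put $\|f\|_{\mathcal H}=\infty$ if $f\notin\mathcal H$, and $$\mathcal E(x,\mu,y)=\sum_{m=1}^M\|\dot x^{(m)}\|_{\mathcal H}^2+\sum_{m=1}^M\|\dot\mu^{(m)}\|_{\mathcal H}^2+\sum_{m=1}^P\|\dot y^{(m)}\|_{\mathcal H}^2 .$$ For $t_1,\dots,t_N\in[0,T]$, a *ridgeless kernel solution* is a minimizer $(\hat x_N,\hat\mu_N,\hat y_N)$ of $\mathcal E$ among all triples of the form $\hat x(t)=x_0+\int_0^t\hat{\dot x}$, $\hat\mu(t)=\hat\mu_0+\int_0^t\hat{\dot\mu}$, $\hat y(t)=\hat y_0+\int_0^t\hat{\dot y}$, where all components of $\hat{\dot x},\hat{\dot\mu},\hat{\dot y}$ lie in $\mathcal H$ and $\|\hat\mu_0\|_\infty,\|\hat y_0\|_\infty\le K$, that satisfy the three equations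 of (DAE) at $t=t_1,\dots,t_N$. Then: 1. There is $(x^*,\mu^*,y^*)\in\mathbb S$ with $\mathcal E(x^*,\mu^*,y^*)=\min_{\mathbb S}\mathcal E<\infty$. 2. For all $N$ and all $t_1,\dots,t_N\in[0,T]$ a ridgeless kernel solution exists. 3. Let $t_1,t_2,\dots$ be i.i.d. uniform on $[0,T]$. Almost surely, for every choice of ridgeless kernel solutions $(\hat x_N,\hat\mu_N,\hat y_N)$ for $t_1,\dots,t_N$ ($N\ge0$): (a) the equations hold almost everywhere in the limit: for almost every $s\in[0,T]$, the residuals $\hat{\dot x}_N-F(\hat x_N,\hat\mu_N,\hat y_N)$, $\hat{\dot\mu}_N-r\hat\mu_N+\hat\mu_N\odot G(\hat x_N,\hat\mu_N,\hat y_N)$ and $H(\hat x_N,\hat\mu_N,\hat y_N)$ at $s$ tend to $0$ as $N\to\infty$, and whenever a subsequence of $(\hat x_N,\hat\mu_N,\hat y_N)$ converges pointwise on $[0,T]$, its limit belongs to $\mathbb S$; (b) $\displaystyle\lim_{N\to\infty}\mathcal E(\hat x_N,\hat\mu_N,\hat y_N)=\inf_{\mathbb S}\mathcal E.$ -/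

import Mathlib

open MeasureTheory Set Filter Topology
open scoped NNReal ENNReal

/-! ### The Matérn-1/2 reproducing kernel Hilbert space on `[0, T]` -/

/-- The Matérn-1/2 kernel `k(s, t) = σ² exp (-|s - t| / ℓ)` on `[0, T]`, as an operator-valued
kernel matrix. -/
noncomputable def maternKernel (σ ℓ T : ℝ) :
    Matrix (Icc (0 : ℝ) T) (Icc (0 : ℝ) T) (ℝ →L[ℝ] ℝ) :=
  Matrix.of fun s t => (σ ^ 2 * Real.exp (-|(s : ℝ) - t| / ℓ)) • ContinuousLinearMap.id ℝ ℝ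

/-- An `L²` feature vector, used only to show that the Matérn-1/2 kernel is positive
semidefinite. -/
noncomputable def maternFeature (ℓ s : ℝ) : Lp ℝ 2 (volume : Measure ℝ) :=
  Real.exp (-s / ℓ) • indicatorConstLp 2 (μ := (volume : Measure ℝ))
    (measurableSet_Icc (a := 0) (b := Real.exp (2 * s / ℓ))) measure_Icc_lt_top.ne (1 : ℝ)

theorem inner_maternFeature {ℓ : ℝ} (hℓ : 0 < ℓ) (s t : ℝ) :
    inner ℝ (maternFeature ℓ s) (maternFeature ℓ t) = Real.exp (-|s - t| / ℓ) := by
  unfold maternFeature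
  rw [real_inner_smul_left, real_inner_smul_right,
    L2.real_inner_indicatorConstLp_one_indicatorConstLp_one _ _ measure_Icc_lt_top.ne
      measure_Icc_lt_top.ne, Icc_inter_Icc]
  simp only [max_self, Real.volume_real_Icc, sub_zero]
  rcases le_total s t with h | h
  · have : Real.exp (2 * s / ℓ) ≤ Real.exp (2 * t / ℓ) := by gcongr
    rw [min_eq_left this, max_eq_left (Real.exp_pos _).le, abs_of_nonpos (by linarith),
      ← Real.exp_add, ← Real.exp_add]
    congr 1; field_simp; ring
  · have : Real.exp (2 * t / ℓ) ≤ Real.exp (2 * s / ℓ) := by gcongr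
    rw [min_eq_right this, max_eq_left (Real.exp_pos _).le, abs_of_nonneg (by linarith),
      ← Real.exp_add, ← Real.exp_add]
    congr 1; field_simp; ring

theorem maternKernel_posSemidef (σ T : ℝ) {ℓ : ℝ} (hℓ : 0 < ℓ) :
    (maternKernel σ ℓ T).PosSemidef := by
  have h02 := (RKHS.posSemidef_tfae (K := maternKernel σ ℓ T)).out 0 2
  refine h02.mpr ⟨?_, fun v => ?_⟩
  · ext s t
    have hid : star (ContinuousLinearMap.id ℝ ℝ) = ContinuousLinearMap.id ℝ ℝ := star_one (ℝ →L[ℝ] ℝ)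
    simp [maternKernel, Matrix.conjTranspose_apply, abs_sub_comm, hid]
  · have h : (v.sum fun x w => v.sum fun x' w' => inner ℝ (maternKernel σ ℓ T x' x w) w')
        = σ ^ 2 * inner ℝ (v.sum fun x w => w • maternFeature ℓ x)
            (v.sum fun x w => w • maternFeature ℓ x) := by
      simp only [Finsupp.sum, sum_inner, inner_sum, Finset.mul_sum, real_inner_smul_left,
        real_inner_smul_right, inner_maternFeature hℓ]
      rw [Finset.sum_comm]
      refine Finset.sum_congr rfl fun x _ => Finset.sum_congr rfl fun y _ => ?_
      simp only [maternKernel, Matrix.of_apply, _root_.smul_apply,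
        ContinuousLinearMap.id_apply, smul_eq_mul, RCLike.inner_apply, conj_trivial,
        abs_sub_comm (x : ℝ) y]
      ring
    rw [h]
    exact mul_nonneg (sq_nonneg _) real_inner_self_nonneg

instance maternKernel_fact (σ ℓ T : ℝ) [hℓ : Fact (0 < ℓ)] :
    Fact (maternKernel σ ℓ T).PosSemidef :=
  ⟨maternKernel_posSemidef σ T hℓ.out⟩

/-- The reproducing kernel Hilbert space of real functions on `[0, T]` whose kernel is the
Matérn-1/2 kernel. -/
abbrev MaternRKHS (σ ℓ T : ℝ) [Fact (0 < ℓ)] := RKHS.OfKernel (maternKernel σ ℓ T)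

/-- The function on `[0, T]` given by an element of the Matérn-1/2 RKHS, extended by zero to `ℝ`
(only its values on `[0, T]` are ever used). -/
noncomputable def maternEval (σ ℓ T : ℝ) [Fact (0 < ℓ)] (h : MaternRKHS σ ℓ T) (t : ℝ) : ℝ :=
  open Classical in if ht : t ∈ Icc (0 : ℝ) T then h ⟨t, ht⟩ else 0

/-- The squared RKHS norm of the restriction of `f` to `[0, T]`; it is `∞` if that restriction does
not belong to the RKHS. -/
noncomputable def maternNormSq (σ ℓ T : ℝ) [Fact (0 < ℓ)] (f : ℝ → ℝ) : ℝ≥0∞ :=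
  ⨅ (h : MaternRKHS σ ℓ T) (_ : ∀ t : Icc (0 : ℝ) T, h t = f t), ‖h‖ₑ ^ 2

/-! ### The differential-algebraic equation -/

/-- Values `(x, μ, y)`. Products and powers of `ℝ` carry the sup norm. -/
abbrev DAEState (M P : ℕ) := (Fin M → ℝ) × (Fin M → ℝ) × (Fin P → ℝ)

/-- The primitives of the system
`x' = F(x, μ, y)`, `μ' = r μ - μ ⊙ G(x, μ, y)`, `0 = H(x, μ, y)`. -/
structure DAE (M P : ℕ) where
  F : DAEState M P → Fin M → ℝ
  G : DAEState M P → Fin M → ℝ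
  H : DAEState M P → Fin P → ℝ
  r : ℝ

/-- `f` is globally Lipschitz with some finite constant. -/
def IsLipschitz {E E' : Type*} [PseudoEMetricSpace E] [PseudoEMetricSpace E'] (f : E → E') : Prop :=
  ∃ L : ℝ≥0, LipschitzWith L f

/-- `f` is, on `[0, T]`, Lipschitz and differentiable with a Lipschitz derivative. -/
def IsLipschitzC1On (T : ℝ) (f : ℝ → ℝ) : Prop :=
  (∃ L : ℝ≥0, LipschitzOnWith L f (Icc 0 T)) ∧ DifferentiableOn ℝ f (Icc 0 T) ∧
    ∃ L : ℝ≥0, LipschitzOnWith L (derivWithin f (Icc 0 T)) (Icc 0 T)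

namespace DAE

variable {M P : ℕ}

/-- `F`, `G`, `H` are Lipschitz, `F` and `G` have Lipschitz first derivatives, and `H` has Lipschitz
first and second derivatives. -/
structure LipschitzPrimitives (D : DAE M P) : Prop where
  F_lip : IsLipschitz D.F
  G_lip : IsLipschitz D.G
  H_lip : IsLipschitz D.H
  F_diff : Differentiable ℝ D.F
  G_diff : Differentiable ℝ D.G
  H_diff : Differentiable ℝ D.H
  F_deriv_lip : IsLipschitz (fderiv ℝ D.F)
  G_deriv_lip : IsLipschitz (fderiv ℝ D.G)
  H_deriv_lip : IsLipschitz (fderiv ℝ D.H)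
  H_diff2 : Differentiable ℝ (fderiv ℝ D.H)
  H_deriv2_lip : IsLipschitz (fderiv ℝ (fderiv ℝ D.H))

/-- The right-hand side `r μ - μ ⊙ G(x, μ, y)` of the co-state equation. -/
def B (D : DAE M P) (w : DAEState M P) : Fin M → ℝ := D.r • w.2.1 - w.2.1 * D.G w

/-- The residual of the system for a value `w` and a velocity `v`. -/
def residual (D : DAE M P) (v w : DAEState M P) : DAEState M P :=
  (v.1 - D.F w, v.2.1 - D.B w, D.H w)

/-- The Jacobian matrix of `H` with respect to `y`. -/
noncomputable def jacY (D : DAE M P) (w : DAEState M P) : Matrix (Fin P) (Fin P) ℝ :=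
  LinearMap.toMatrix'
    (fderiv ℝ (fun v : Fin P → ℝ => D.H (w.1, w.2.1, v)) w.2.2 : (Fin P → ℝ) →ₗ[ℝ] (Fin P → ℝ))

/-- Along the trajectory `z` on `[0, T]`, the Jacobian of `H` with respect to `y` is nonsingular,
and its inverse is Lipschitz with a Lipschitz first derivative. -/
structure RegularAlong (D : DAE M P) (T : ℝ) (z : ℝ → DAEState M P) : Prop where
  det_ne_zero : ∀ t ∈ Icc 0 T, (D.jacY (z t)).det ≠ 0
  inv_lip : ∀ i j, IsLipschitzC1On T fun t => (D.jacY (z t))⁻¹ i j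

/-- `z = (x, μ, y)` is differentiable on `[0, T]`, solves the differential-algebraic equation there,
and has `x(0) = x₀`. -/
structure IsSolution (D : DAE M P) (T : ℝ) (x₀ : Fin M → ℝ) (z : ℝ → DAEState M P) : Prop where
  init : (z 0).1 = x₀
  deriv_x : ∀ t ∈ Icc 0 T, HasDerivWithinAt (fun s => (z s).1) (D.F (z t)) (Icc 0 T) t
  deriv_mu : ∀ t ∈ Icc 0 T, HasDerivWithinAt (fun s => (z s).2.1) (D.B (z t)) (Icc 0 T) t
  diff_y : DifferentiableOn ℝ (fun s => (z s).2.2) (Icc 0 T)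
  constraint : ∀ t ∈ Icc 0 T, D.H (z t) = 0

/-- The solutions on `[0, T]` with `‖μ(0)‖_∞ ≤ K` and `‖y(0)‖_∞ ≤ K`. -/
def boundedSolutions (D : DAE M P) (T : ℝ) (x₀ : Fin M → ℝ) (K : ℝ) : Set (ℝ → DAEState M P) :=
  {z | D.IsSolution T x₀ z ∧ ‖(z 0).2.1‖ ≤ K ∧ ‖(z 0).2.2‖ ≤ K}

/-- The set `𝕊` of those solutions that moreover satisfy the regularity assumption. -/
def regularSolutions (D : DAE M P) (T : ℝ) (x₀ : Fin M → ℝ) (K : ℝ) : Set (ℝ → DAEState M P) :=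
  {z ∈ D.boundedSolutions T x₀ K | D.RegularAlong T z}

end DAE

/-- `∑ ‖x'ₘ‖² + ∑ ‖μ'ₘ‖² + ∑ ‖y'ₘ‖²`, with the Matérn-1/2 RKHS norms of the derivatives on
`[0, T]`. -/
noncomputable def derivEnergy (σ ℓ T : ℝ) [Fact (0 < ℓ)] {M P : ℕ} (z : ℝ → DAEState M P) : ℝ≥0∞ :=
  (∑ m, maternNormSq σ ℓ T (derivWithin (fun s => (z s).1 m) (Icc 0 T))) +
  (∑ m, maternNormSq σ ℓ T (derivWithin (fun s => (z s).2.1 m) (Icc 0 T))) +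
  ∑ m, maternNormSq σ ℓ T (derivWithin (fun s => (z s).2.2 m) (Icc 0 T))

/-! ### Ridgeless kernel regression -/

/-- The unknowns of the ridgeless kernel regression: the derivatives of `x`, `μ`, `y`, with all
components in the Matérn-1/2 RKHS, and the initial values of `μ` and `y`. -/
structure KernelCandidate (σ ℓ T : ℝ) [Fact (0 < ℓ)] (M P : ℕ) where
  dx : Fin M → MaternRKHS σ ℓ T
  dmu : Fin M → MaternRKHS σ ℓ T
  dy : Fin P → MaternRKHS σ ℓ T
  mu0 : Fin M → ℝ
  y0 : Fin P → ℝ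

namespace KernelCandidate

variable {σ ℓ T : ℝ} [Fact (0 < ℓ)] {M P : ℕ}

/-- The derivatives as functions of time. -/
noncomputable def vel (c : KernelCandidate σ ℓ T M P) (t : ℝ) : DAEState M P :=
  (fun m => maternEval σ ℓ T (c.dx m) t,
    fun m => maternEval σ ℓ T (c.dmu m) t,
    fun m => maternEval σ ℓ T (c.dy m) t)

/-- The functions obtained from the derivatives by integration from the initial values. -/
noncomputable def traj (c : KernelCandidate σ ℓ T M P) (x₀ : Fin M → ℝ) (t : ℝ) : DAEState M P :=
  (fun m => x₀ m + ∫ τ in (0 : ℝ)..t, maternEval σ ℓ T (c.dx m) τ,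
    fun m => c.mu0 m + ∫ τ in (0 : ℝ)..t, maternEval σ ℓ T (c.dmu m) τ,
    fun m => c.y0 m + ∫ τ in (0 : ℝ)..t, maternEval σ ℓ T (c.dy m) τ)

/-- The sum of the squared RKHS norms of the derivatives. -/
noncomputable def energy (c : KernelCandidate σ ℓ T M P) : ℝ :=
  (∑ m, ‖c.dx m‖ ^ 2) + (∑ m, ‖c.dmu m‖ ^ 2) + ∑ m, ‖c.dy m‖ ^ 2

/-- The initial values are bounded by `K`, and the system holds at all collocation points. -/
def Feasible (D : DAE M P) (x₀ : Fin M → ℝ) (K : ℝ) {N : ℕ} (p : Fin N → Icc (0 : ℝ) T)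
    (c : KernelCandidate σ ℓ T M P) : Prop :=
  ‖c.mu0‖ ≤ K ∧ ‖c.y0‖ ≤ K ∧ ∀ i, D.residual (c.vel (p i)) (c.traj x₀ (p i)) = 0

/-- `c` is a ridgeless kernel solution for the collocation points `p`: it has minimal energy among
all feasible candidates. -/
def IsRidgeless (D : DAE M P) (x₀ : Fin M → ℝ) (K : ℝ) {N : ℕ} (p : Fin N → Icc (0 : ℝ) T)
    (c : KernelCandidate σ ℓ T M P) : Prop :=
  Feasible D x₀ K p c ∧ ∀ c' : KernelCandidate σ ℓ T M P, Feasible D x₀ K p c' → c.energy ≤ c'.energy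

end KernelCandidate

/-! The proof is the direct method of the calculus of variations, with collocation on a dense set
replacing the full system. Point evaluation and integration over `[0, t]` are continuous functionals
on the RKHS, so weak convergence of derivatives, together with convergence of initial values, forces
pointwise convergence of velocities and trajectories, hence of residuals
(`WeakLimit.tendsto_residual`). Bounded candidates have weak limits along every ultrafilter
(`exists_weakLimit`), and the energy is weakly lower semicontinuous (`WeakLimit.energy_le`). This
yields minimizers under the constraint that the system holds on any prescribed set of times,
provided some candidate satisfies it.

Candidates that satisfy the system on all of `[0, T]` correspond to regular solutions of the same
energy. The substantial direction is that a regular solution has finite energy. Differentiating `0 =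
H` expresses `y'` through the inverse Jacobian, so the velocity is Lipschitz
(`isLipschitzOn_impliedVel`). Lipschitz functions belong to the Matérn-1/2 space
(`exists_maternRKHS_of_isLipschitzOn`), because the kernel is the Gram kernel of scaled indicators
in `L²` and a Lipschitz function is an integral of its bounded derivative.

Independent uniform points are almost surely dense. An exact candidate `b` of least energy is
feasible for every collocation problem, so ridgeless solutions have energy at most that of `b`. Each
of their weak limits satisfies the system on a dense set, hence everywhere by continuity, and
therefore has at least the energy of `b`. Both bounds together give convergence of the energies. -/

/-! ### The Matérn-1/2 RKHS -/

section MaternRKHS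

variable {σ ℓ T : ℝ} [hℓ : Fact (0 < ℓ)]

/-- The kernel section at `t`, as an element of the Matérn-1/2 RKHS. -/
noncomputable def maternSection (σ ℓ T : ℝ) [Fact (0 < ℓ)] (t : Icc (0 : ℝ) T) :
    MaternRKHS σ ℓ T :=
  RKHS.kerFun (MaternRKHS σ ℓ T) t 1

theorem inner_maternSection_right (h : MaternRKHS σ ℓ T) (t : Icc (0 : ℝ) T) :
    inner ℝ h (maternSection σ ℓ T t) = h t := by
  simp [maternSection]

theorem maternSection_apply (s t : Icc (0 : ℝ) T) :
    maternSection σ ℓ T s t = σ ^ 2 * Real.exp (-|(s : ℝ) - t| / ℓ) := by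
  rw [maternSection, RKHS.kerFun_apply, RKHS.OfKernel.kernel_ofKernel, abs_sub_comm]
  simp [maternKernel]

theorem norm_maternSection_sub_sq (s t : Icc (0 : ℝ) T) :
    ‖maternSection σ ℓ T s - maternSection σ ℓ T t‖ ^ 2 =
      2 * σ ^ 2 * (1 - Real.exp (-|(s : ℝ) - t| / ℓ)) := by
  rw [norm_sub_sq_real, ← real_inner_self_eq_norm_sq, ← real_inner_self_eq_norm_sq]
  simp only [inner_maternSection_right, maternSection_apply]
  simp
  ring

theorem norm_maternSection (t : Icc (0 : ℝ) T) : ‖maternSection σ ℓ T t‖ = |σ| := by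
  rw [← abs_norm, ← sq_eq_sq_iff_abs_eq_abs, ← real_inner_self_eq_norm_sq,
    inner_maternSection_right, maternSection_apply]
  simp

/-- The kernel distance `2σ²(1 - exp(-|s - t|/ℓ))` vanishes as `s → t`. By the reproducing property,
this makes every element of the RKHS a continuous function. -/
theorem continuous_maternSection : Continuous (maternSection σ ℓ T) := by
  refine continuous_iff_continuousAt.2 fun t => ?_
  rw [ContinuousAt, tendsto_iff_norm_sub_tendsto_zero]
  have h : Continuous fun s : Icc (0 : ℝ) T =>
      √(2 * σ ^ 2 * (1 - Real.exp (-|(s : ℝ) - t| / ℓ))) := by fun_prop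
  have h' := h.tendsto t
  simp only [sub_self, abs_zero, neg_zero, zero_div, Real.exp_zero, mul_zero, Real.sqrt_zero] at h'
  refine h'.congr fun s => ?_
  rw [← norm_maternSection_sub_sq, Real.sqrt_sq (norm_nonneg _)]

theorem MaternRKHS.continuous (h : MaternRKHS σ ℓ T) : Continuous fun t => h t := by
  simp_rw [← inner_maternSection_right h]
  exact continuous_const.inner continuous_maternSection

theorem MaternRKHS.abs_apply_le (h : MaternRKHS σ ℓ T) (t : Icc (0 : ℝ) T) :
    |h t| ≤ |σ| * ‖h‖ := by
  rw [← inner_maternSection_right, mul_comm, ← norm_maternSection (σ := σ) (ℓ := ℓ) t]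
  exact abs_real_inner_le_norm _ _

theorem maternEval_of_mem (h : MaternRKHS σ ℓ T) {t : ℝ} (ht : t ∈ Icc 0 T) :
    maternEval σ ℓ T h t = h ⟨t, ht⟩ := by
  simp [maternEval, ht]

theorem maternEval_coe (h : MaternRKHS σ ℓ T) (t : Icc (0 : ℝ) T) :
    maternEval σ ℓ T h t = h t := maternEval_of_mem h t.2

theorem continuousOn_maternEval (h : MaternRKHS σ ℓ T) :
    ContinuousOn (maternEval σ ℓ T h) (Icc 0 T) := by
  rw [continuousOn_iff_continuous_domRestrict]
  refine h.continuous.congr fun t => ?_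
  simp [maternEval_coe]

theorem intervalIntegrable_maternEval (h : MaternRKHS σ ℓ T) {t : ℝ} (ht : t ∈ Icc 0 T) :
    IntervalIntegrable (maternEval σ ℓ T h) volume 0 t :=
  ((continuousOn_maternEval h).mono (Icc_subset_Icc_right ht.2)).intervalIntegrable_of_Icc ht.1

/-- Point evaluation, as a continuous functional on the Matérn-1/2 RKHS. -/
noncomputable def maternEvalCLM (σ ℓ T : ℝ) [Fact (0 < ℓ)] (t : Icc (0 : ℝ) T) :
    StrongDual ℝ (MaternRKHS σ ℓ T) :=
  innerSL ℝ (maternSection σ ℓ T t)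

theorem maternEvalCLM_apply (t : Icc (0 : ℝ) T) (h : MaternRKHS σ ℓ T) :
    maternEvalCLM σ ℓ T t h = maternEval σ ℓ T h t := by
  rw [maternEvalCLM, innerSL_apply_apply, real_inner_comm, inner_maternSection_right,
    maternEval_coe]

/-- Integration over `[0, t]`, as a continuous functional on the Matérn-1/2 RKHS. -/
noncomputable def maternIntegralCLM (σ ℓ T : ℝ) [Fact (0 < ℓ)] (t : Icc (0 : ℝ) T) :
    StrongDual ℝ (MaternRKHS σ ℓ T) :=
  LinearMap.mkContinuous
    { toFun := fun h => ∫ τ in (0 : ℝ)..t, maternEval σ ℓ T h τ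
      map_add' := fun f g => by
        rw [← intervalIntegral.integral_add (intervalIntegrable_maternEval f t.2)
          (intervalIntegrable_maternEval g t.2)]
        refine intervalIntegral.integral_congr fun τ hτ => ?_
        rw [uIcc_of_le t.2.1] at hτ
        have hτ' : τ ∈ Icc 0 T := Icc_subset_Icc_right t.2.2 hτ
        simp [maternEval_of_mem _ hτ']
      map_smul' := fun a f => by
        rw [RingHom.id_apply, ← intervalIntegral.integral_smul]
        refine intervalIntegral.integral_congr fun τ hτ => ?_
        rw [uIcc_of_le t.2.1] at hτ
        have hτ' : τ ∈ Icc 0 T := Icc_subset_Icc_right t.2.2 hτ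
        simp [maternEval_of_mem _ hτ'] }
    (|σ| * T) fun h => by
      have hb : ∀ τ ∈ uIoc (0 : ℝ) t, ‖maternEval σ ℓ T h τ‖ ≤ |σ| * ‖h‖ := fun τ hτ => by
        rw [uIoc_of_le t.2.1] at hτ
        rw [maternEval_of_mem h ⟨hτ.1.le, hτ.2.trans t.2.2⟩]
        exact h.abs_apply_le _
      have h1 := intervalIntegral.norm_integral_le_of_norm_le_const hb
      refine h1.trans ?_
      rw [sub_zero, abs_of_nonneg t.2.1, mul_right_comm]
      gcongr
      exact t.2.2

theorem denseRange_linearCombination_maternSection :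
    DenseRange (Finsupp.linearCombination ℝ (maternSection σ ℓ T)) := by
  have h1 : Submodule.span ℝ {RKHS.kerFun (MaternRKHS σ ℓ T) x v | (x) (v)} ≤
      LinearMap.range (Finsupp.linearCombination ℝ (maternSection σ ℓ T)) := by
    rw [Finsupp.range_linearCombination, Submodule.span_le]
    rintro _ ⟨x, v, rfl⟩
    have : RKHS.kerFun (MaternRKHS σ ℓ T) x v = v • maternSection σ ℓ T x := by
      rw [maternSection, ← map_smul]; simp
    rw [this]
    exact Submodule.smul_mem _ _ (Submodule.subset_span ⟨x, rfl⟩)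
  have h2 := Submodule.topologicalClosure_mono h1
  rw [RKHS.kerFun_dense, top_le_iff] at h2
  rw [DenseRange, ← LinearMap.coe_range]
  exact Submodule.dense_iff_topologicalClosure_eq_top.2 h2

/-- Every `L²` function defines an element of the RKHS through the feature map. -/
theorem exists_maternRKHS_eq_inner (hσ : σ ≠ 0) (g : Lp ℝ 2 (volume : Measure ℝ)) :
    ∃ h : MaternRKHS σ ℓ T, ∀ t : Icc (0 : ℝ) T, h t = inner ℝ g (maternFeature ℓ t) := by
  set e := Finsupp.linearCombination ℝ (maternSection σ ℓ T)
  set f := Finsupp.linearCombination ℝ fun t : Icc (0 : ℝ) T => maternFeature ℓ t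
  -- Sections and features have the same Gram matrix up to the factor `σ²`, so the map from sections
  -- to features is well defined and bounded on the dense span of the sections.
  have hn : ∀ v, ‖f v‖ ≤ |σ|⁻¹ * ‖e v‖ := fun v => by
    have hsq : ‖e v‖ ^ 2 = σ ^ 2 * ‖f v‖ ^ 2 := by
      rw [← real_inner_self_eq_norm_sq, ← real_inner_self_eq_norm_sq]
      simp only [e, f, Finsupp.linearCombination_apply, Finsupp.sum, sum_inner, inner_sum,
        Finset.mul_sum, real_inner_smul_left, real_inner_smul_right, inner_maternFeature hℓ.out,
        inner_maternSection_right, maternSection_apply]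
      refine Finset.sum_congr rfl fun x _ => Finset.sum_congr rfl fun y _ => ?_
      ring
    have h2 : ‖e v‖ = |σ| * ‖f v‖ := by
      rw [← sq_eq_sq₀ (norm_nonneg _) (by positivity), hsq, mul_pow, sq_abs]
    rw [h2, inv_mul_cancel_left₀ (abs_ne_zero.2 hσ)]
  set W := f.extendOfNorm e
  have hW : ∀ t, W (maternSection σ ℓ T t) = maternFeature ℓ t := fun t => by
    have := LinearMap.extendOfNorm_eq denseRange_linearCombination_maternSection ⟨_, hn⟩
      (Finsupp.single t 1)
    simpa [e, f, W] using this
  -- Evaluation at `t` is the inner product with the section at `t`, which `W` carries to the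
  -- feature at `t`; the adjoint therefore pulls `g` back to the required function.
  refine ⟨ContinuousLinearMap.adjoint W g, fun t => ?_⟩
  rw [← inner_maternSection_right, ContinuousLinearMap.adjoint_inner_left, hW]

end MaternRKHS

/-! ### Lipschitz functions on a compact set -/

section LipschitzOn

variable {α E F G : Type*} [PseudoMetricSpace α] [NormedAddCommGroup E]
  [NormedAddCommGroup F] [NormedAddCommGroup G] {s : Set α}

/-- `f` is Lipschitz on `s` with some finite constant. -/
def IsLipschitzOn {β γ : Type*} [PseudoEMetricSpace β] [PseudoEMetricSpace γ] (f : β → γ)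
    (s : Set β) : Prop :=
  ∃ L : ℝ≥0, LipschitzOnWith L f s

theorem IsLipschitzOn.continuousOn {f : α → E} (hf : IsLipschitzOn f s) : ContinuousOn f s :=
  hf.choose_spec.continuousOn

theorem IsLipschitzOn.neg {f : α → E} (hf : IsLipschitzOn f s) :
    IsLipschitzOn (fun x => -f x) s := by
  obtain ⟨L, hL⟩ := hf
  exact ⟨L, fun x hx y hy => by rw [edist_neg_neg]; exact hL hx hy⟩

theorem IsLipschitzOn.sub {f g : α → E} (hf : IsLipschitzOn f s) (hg : IsLipschitzOn g s) :
    IsLipschitzOn (fun x => f x - g x) s := by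
  obtain ⟨L, hL⟩ := hf
  obtain ⟨L', hL'⟩ := hg
  exact ⟨L + L', hL.sub hL'⟩

theorem IsLipschitzOn.sum {ι : Type*} (t : Finset ι) {f : ι → α → E}
    (hf : ∀ i ∈ t, IsLipschitzOn (f i) s) : IsLipschitzOn (fun x => ∑ i ∈ t, f i x) s := by
  classical
  induction t using Finset.induction_on with
  | empty => exact ⟨0, by simp⟩
  | insert a t ha ih =>
    simp only [Finset.sum_insert ha]
    obtain ⟨L, hL⟩ := hf a (Finset.mem_insert_self a t)
    obtain ⟨L', hL'⟩ := ih fun i hi => hf i (Finset.mem_insert_of_mem hi)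
    exact ⟨L + L', hL.add hL'⟩

theorem IsLipschitzOn.prodMk {f : α → E} {g : α → F} (hf : IsLipschitzOn f s)
    (hg : IsLipschitzOn g s) : IsLipschitzOn (fun x => (f x, g x)) s := by
  obtain ⟨L, hL⟩ := hf
  obtain ⟨L', hL'⟩ := hg
  exact ⟨max L L', hL.prodMk hL'⟩

theorem isLipschitzOn_pi {ι : Type*} [Fintype ι] {f : α → ι → ℝ} :
    IsLipschitzOn f s ↔ ∀ i, IsLipschitzOn (fun x => f x i) s := by
  refine ⟨fun ⟨L, hL⟩ i => ⟨L, fun x hx y hy => (edist_le_pi_edist _ _ i).trans (hL hx hy)⟩,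
    fun h => ?_⟩
  choose L hL using h
  refine ⟨∑ i, L i, fun x hx y hy => edist_pi_le_iff.2 fun i => (hL i hx hy).trans ?_⟩
  gcongr
  exact Finset.single_le_sum (f := L) (fun _ _ => zero_le) (Finset.mem_univ i)

theorem IsLipschitz.comp_isLipschitzOn {β γ : Type*} [PseudoEMetricSpace β] [PseudoEMetricSpace γ]
    {g : β → γ} (hg : IsLipschitz g) {f : α → β} (hf : IsLipschitzOn f s) :
    IsLipschitzOn (fun x => g (f x)) s := by
  obtain ⟨L, hL⟩ := hf
  obtain ⟨L', hL'⟩ := hg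
  exact ⟨L' * L, hL'.comp_lipschitzOnWith hL⟩

variable [NormedSpace ℝ E] [NormedSpace ℝ F] [NormedSpace ℝ G]

/-- On a compact set, a bilinear map preserves the Lipschitz property. -/
theorem IsLipschitzOn.bilinear (hs : IsCompact s) (B : E →L[ℝ] F →L[ℝ] G) {f : α → E} {g : α → F}
    (hf : IsLipschitzOn f s) (hg : IsLipschitzOn g s) :
    IsLipschitzOn (fun x => B (f x) (g x)) s := by
  obtain ⟨Cf, hCf⟩ := hs.exists_bound_of_continuousOn hf.continuousOn
  obtain ⟨Cg, hCg⟩ := hs.exists_bound_of_continuousOn hg.continuousOn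
  obtain ⟨L, hL⟩ := hf
  obtain ⟨L', hL'⟩ := hg
  refine ⟨(‖B‖ * (|Cf| * L' + L * |Cg|)).toNNReal,
    LipschitzOnWith.of_dist_le_mul fun x hx y hy => ?_⟩
  rw [Real.coe_toNNReal _ (by positivity), dist_eq_norm]
  -- The product-rule splitting leaves one undifferenced factor in each term; compactness bounds it.
  have e : B (f x) (g x) - B (f y) (g y) = B (f x) (g x - g y) + B (f x - f y) (g y) := by
    simp
  have h1 : ‖f x - f y‖ ≤ L * dist x y := by
    rw [← dist_eq_norm]; exact hL.dist_le_mul x hx y hy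
  have h2 : ‖g x - g y‖ ≤ L' * dist x y := by
    rw [← dist_eq_norm]; exact hL'.dist_le_mul x hx y hy
  calc ‖B (f x) (g x) - B (f y) (g y)‖
      ≤ ‖B (f x) (g x - g y)‖ + ‖B (f x - f y) (g y)‖ := e ▸ norm_add_le _ _
    _ ≤ ‖B‖ * ‖f x‖ * ‖g x - g y‖ + ‖B‖ * ‖f x - f y‖ * ‖g y‖ := by
      gcongr <;> exact B.le_opNorm₂ _ _
    _ ≤ ‖B‖ * |Cf| * (L' * dist x y) + ‖B‖ * (L * dist x y) * |Cg| := by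
      gcongr
      · exact (hCf x hx).trans (le_abs_self _)
      · exact (hCg y hy).trans (le_abs_self _)
    _ = ‖B‖ * (|Cf| * L' + L * |Cg|) * dist x y := by ring

theorem IsLipschitzOn.mul (hs : IsCompact s) {f g : α → ℝ}
    (hf : IsLipschitzOn f s) (hg : IsLipschitzOn g s) : IsLipschitzOn (fun x => f x * g x) s :=
  hf.bilinear hs (ContinuousLinearMap.mul ℝ ℝ) hg

theorem IsLipschitzOn.clm_apply (hs : IsCompact s) {f : α → E →L[ℝ] F} {g : α → E}
    (hf : IsLipschitzOn f s) (hg : IsLipschitzOn g s) : IsLipschitzOn (fun x => f x (g x)) s :=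
  hf.bilinear hs (ContinuousLinearMap.id ℝ (E →L[ℝ] F)) hg

/-- A function with a continuous derivative on `[a, b]` is Lipschitz there. -/
theorem isLipschitzOn_Icc_of_hasDerivWithinAt {a b : ℝ} {f f' : ℝ → E}
    (hf : ∀ t ∈ Icc a b, HasDerivWithinAt f (f' t) (Icc a b) t) (hf' : ContinuousOn f' (Icc a b)) :
    IsLipschitzOn f (Icc a b) := by
  obtain ⟨C, hC⟩ := isCompact_Icc.exists_bound_of_continuousOn hf'
  refine ⟨|C|.toNNReal, (convex_Icc a b).lipschitzOnWith_of_nnnorm_hasDerivWithin_le hf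
    fun t ht => ?_⟩
  rw [← NNReal.coe_le_coe, Real.coe_toNNReal _ (abs_nonneg C)]
  exact (hC t ht).trans (le_abs_self C)

end LipschitzOn

/-! ### Lipschitz functions belong to the Matérn-1/2 RKHS -/

section LipschitzMatern

theorem inner_maternFeature_right (ℓ : ℝ) (g : Lp ℝ 2 (volume : Measure ℝ)) (s : ℝ) :
    inner ℝ g (maternFeature ℓ s) =
      Real.exp (-s / ℓ) * ∫ u in Icc 0 (Real.exp (2 * s / ℓ)), g u := by
  rw [maternFeature, real_inner_smul_right, real_inner_comm, L2.inner_indicatorConstLp_one]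

variable {σ ℓ T : ℝ} [hℓ : Fact (0 < ℓ)]

/-- With `u = exp(2s/ℓ)`, the inner product of `g` with the feature at `s` is the integral of `g`
over `[0, u]` divided by `√u`. Representing `f` thus means writing `√u * f(ℓ/2 * log u)` as an
integral; on `u ≥ 1` the square root and the logarithm are harmless. -/
theorem isLipschitzOn_sqrt_mul_comp_log {f : ℝ → ℝ} (hf : IsLipschitzOn f (Icc 0 T)) :
    IsLipschitzOn (fun u => √u * f (ℓ / 2 * Real.log u)) (Icc 1 (Real.exp (2 * T / ℓ))) := by
  have hpos := hℓ.out
  refine IsLipschitzOn.mul isCompact_Icc ?_ ?_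
  · refine isLipschitzOn_Icc_of_hasDerivWithinAt (f' := fun u => 1 / (2 * √u)) (fun u hu => ?_) ?_
    · exact (Real.hasDerivAt_sqrt (by linarith [hu.1])).hasDerivWithinAt
    · refine ContinuousOn.div (by fun_prop) (by fun_prop) fun u hu => ?_
      have : 0 < √u := Real.sqrt_pos.2 (by linarith [hu.1])
      positivity
  · obtain ⟨L, hL⟩ := hf
    obtain ⟨L', hL'⟩ : IsLipschitzOn (fun u => ℓ / 2 * Real.log u)
        (Icc 1 (Real.exp (2 * T / ℓ))) := by
      refine isLipschitzOn_Icc_of_hasDerivWithinAt (f' := fun u => ℓ / 2 * u⁻¹) (fun u hu => ?_) ?_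
      · exact ((Real.hasDerivAt_log (by linarith [hu.1])).const_mul _).hasDerivWithinAt
      · exact continuousOn_const.mul (continuousOn_inv₀.mono fun u hu => by
          have := hu.1; simp; linarith)
    refine ⟨L * L', hL.comp hL' fun u hu => ⟨?_, ?_⟩⟩
    · have := Real.log_nonneg hu.1
      positivity
    · have : Real.log u ≤ 2 * T / ℓ := (Real.log_le_iff_le_exp (by linarith [hu.1])).2 hu.2
      calc ℓ / 2 * Real.log u ≤ ℓ / 2 * (2 * T / ℓ) := by gcongr
        _ = T := by field_simp

/-- A Lipschitz function on `[0, T]` is the restriction of an element of the Matérn-1/2 RKHS. -/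
theorem exists_maternRKHS_of_isLipschitzOn (hσ : σ ≠ 0) {f : ℝ → ℝ}
    (hf : IsLipschitzOn f (Icc 0 T)) : ∃ h : MaternRKHS σ ℓ T, ∀ t : Icc (0 : ℝ) T, h t = f t := by
  have hpos := hℓ.out
  set U := Real.exp (2 * T / ℓ)
  obtain ⟨L, hL⟩ := isLipschitzOn_sqrt_mul_comp_log (ℓ := ℓ) hf
  -- A globally Lipschitz extension has a measurable derivative bounded by `L` everywhere and is
  -- absolutely continuous, so it is the integral of that derivative.
  obtain ⟨Φ, hΦ, hΦeq⟩ := hL.extend_real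
  have hmem : MemLp (indicator (Ioc 1 U) (deriv Φ)) 2 volume := by
    rw [memLp_indicator_iff_restrict measurableSet_Ioc]
    exact MemLp.of_bound (measurable_deriv Φ).aestronglyMeasurable L
      (ae_of_all _ fun u => norm_deriv_le_of_lipschitz hΦ)
  -- The `L²` function is `f 0` on `[0, 1]`, where the feature at time `0` lives, and `Φ'` on `(1,
  -- U]`. The first piece supplies the initial value `Φ 1 = f 0`.
  obtain ⟨h, hh⟩ := exists_maternRKHS_eq_inner (T := T) (ℓ := ℓ) hσ
    (f 0 • maternFeature ℓ 0 + hmem.toLp _)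
  refine ⟨h, fun t => ?_⟩
  have h1u : 1 ≤ Real.exp (2 * t / ℓ) := Real.one_le_exp (by have := t.2.1; positivity)
  have huU : Real.exp (2 * t / ℓ) ≤ U := by
    have := t.2.2
    simp only [U]; gcongr
  have hint : ∫ u in Icc 0 (Real.exp (2 * t / ℓ)), hmem.toLp _ u =
      Φ (Real.exp (2 * t / ℓ)) - Φ 1 := by
    have e : Icc 0 (Real.exp (2 * t / ℓ)) ∩ Ioc 1 U = Ioc 1 (Real.exp (2 * t / ℓ)) := by
      ext u; simp only [mem_inter_iff, mem_Icc, mem_Ioc]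
      constructor
      · rintro ⟨⟨-, h2⟩, h3, -⟩; exact ⟨h3, h2⟩
      · rintro ⟨h1, h2⟩; exact ⟨⟨by linarith, h2⟩, h1, h2.trans huU⟩
    rw [integral_congr_ae (ae_restrict_of_ae hmem.coeFn_toLp),
      setIntegral_indicator measurableSet_Ioc, e, ← intervalIntegral.integral_of_le h1u]
    exact hΦ.lipschitzOnWith.absolutelyContinuousOnInterval.integral_deriv_eq_sub
  rw [hh, inner_add_left, real_inner_smul_left, inner_maternFeature hpos,
    inner_maternFeature_right, hint, ← hΦeq ⟨h1u, huU⟩, ← hΦeq ⟨le_rfl, h1u.trans huU⟩]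
  have hs : √(Real.exp (2 * t / ℓ)) = Real.exp (t / ℓ) := by
    rw [← Real.exp_half]; congr 1; ring
  have hl : ℓ / 2 * (2 * (t : ℝ) / ℓ) = t := by field_simp
  have he : Real.exp (-(t : ℝ) / ℓ) * Real.exp (t / ℓ) = 1 := by
    rw [← Real.exp_add, neg_div, neg_add_cancel, Real.exp_zero]
  simp only [Real.log_exp, hs, hl, Real.sqrt_one, Real.log_one, mul_zero, one_mul, zero_sub,
    abs_neg, abs_of_nonneg t.2.1]
  linear_combination f t * he

end LipschitzMatern

/-! ### Weak limits along ultrafilters -/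

/-- A bounded family in a Hilbert space converges weakly along every ultrafilter. -/
theorem exists_weak_limit_of_ultrafilter {ι E : Type*} [NormedAddCommGroup E]
    [InnerProductSpace ℝ E] [CompleteSpace E] (U : Ultrafilter ι) {h : ι → E} {R : ℝ}
    (hR : ∀ᶠ i in (U : Filter ι), ‖h i‖ ≤ R) :
    ∃ a : E, ∀ f : StrongDual ℝ E, Tendsto (fun i => f (h i)) U (𝓝 (f a)) := by
  let Φ : ι → WeakDual ℝ E := fun i =>
    StrongDual.toWeakDual (InnerProductSpace.toDual ℝ E (h i))
  -- The Riesz isometry moves the family into a closed ball of the dual, which is weak-* compact by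
  -- Banach–Alaoglu.
  have hmem : (U.map Φ : Filter (WeakDual ℝ E)) ≤
      𝓟 (WeakDual.toStrongDual ⁻¹' Metric.closedBall 0 R) := by
    refine tendsto_principal.2 (hR.mono fun i hi => ?_)
    simpa [Φ] using hi
  obtain ⟨L, -, hL⟩ := (WeakDual.isCompact_closedBall (0 : StrongDual ℝ E) R).ultrafilter_le_nhds
    (U.map Φ) hmem
  refine ⟨(InnerProductSpace.toDual ℝ E).symm (WeakDual.toStrongDual L), fun f => ?_⟩
  have hT : Tendsto Φ U (𝓝 L) := hL
  have h1 := ((WeakDual.eval_continuous ((InnerProductSpace.toDual ℝ E).symm f)).tendsto L).comp hT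
  have h2 : f ((InnerProductSpace.toDual ℝ E).symm (WeakDual.toStrongDual L)) =
      L ((InnerProductSpace.toDual ℝ E).symm f) := by
    rw [← InnerProductSpace.toDual_symm_apply, real_inner_comm,
      InnerProductSpace.toDual_symm_apply]
    rfl
  rw [h2]
  refine h1.congr fun i => ?_
  rw [← InnerProductSpace.toDual_symm_apply, real_inner_comm]
  exact InnerProductSpace.toDual_apply_apply

/-! ### Kernel candidates -/

namespace KernelCandidate

variable {σ ℓ T : ℝ} [hℓ : Fact (0 < ℓ)] {M P : ℕ}

theorem traj_apply (c : KernelCandidate σ ℓ T M P) (x₀ : Fin M → ℝ) (t : Icc (0 : ℝ) T) :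
    c.traj x₀ t = (fun m => x₀ m + maternIntegralCLM σ ℓ T t (c.dx m),
      fun m => c.mu0 m + maternIntegralCLM σ ℓ T t (c.dmu m),
      fun m => c.y0 m + maternIntegralCLM σ ℓ T t (c.dy m)) := rfl

theorem vel_apply (c : KernelCandidate σ ℓ T M P) (t : Icc (0 : ℝ) T) :
    c.vel t = (fun m => maternEvalCLM σ ℓ T t (c.dx m),
      fun m => maternEvalCLM σ ℓ T t (c.dmu m),
      fun m => maternEvalCLM σ ℓ T t (c.dy m)) := by
  simp only [maternEvalCLM_apply]; rfl

theorem traj_zero (c : KernelCandidate σ ℓ T M P) (x₀ : Fin M → ℝ) :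
    c.traj x₀ 0 = (x₀, c.mu0, c.y0) := by
  simp [traj]

theorem energy_nonneg (c : KernelCandidate σ ℓ T M P) : 0 ≤ c.energy := by
  unfold energy; positivity

theorem norm_dx_le (c : KernelCandidate σ ℓ T M P) (m : Fin M) : ‖c.dx m‖ ≤ √c.energy := by
  refine Real.le_sqrt_of_sq_le ?_
  have h := Finset.single_le_sum (f := fun m => ‖c.dx m‖ ^ 2) (fun _ _ => sq_nonneg _)
    (Finset.mem_univ m)
  have h2 : 0 ≤ ∑ m, ‖c.dmu m‖ ^ 2 := by positivity
  have h3 : 0 ≤ ∑ m, ‖c.dy m‖ ^ 2 := by positivity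
  unfold energy; linarith

theorem norm_dmu_le (c : KernelCandidate σ ℓ T M P) (m : Fin M) : ‖c.dmu m‖ ≤ √c.energy := by
  refine Real.le_sqrt_of_sq_le ?_
  have h := Finset.single_le_sum (f := fun m => ‖c.dmu m‖ ^ 2) (fun _ _ => sq_nonneg _)
    (Finset.mem_univ m)
  have h2 : 0 ≤ ∑ m, ‖c.dx m‖ ^ 2 := by positivity
  have h3 : 0 ≤ ∑ m, ‖c.dy m‖ ^ 2 := by positivity
  unfold energy; linarith

theorem norm_dy_le (c : KernelCandidate σ ℓ T M P) (m : Fin P) : ‖c.dy m‖ ≤ √c.energy := by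
  refine Real.le_sqrt_of_sq_le ?_
  have h := Finset.single_le_sum (f := fun m => ‖c.dy m‖ ^ 2) (fun _ _ => sq_nonneg _)
    (Finset.mem_univ m)
  have h2 : 0 ≤ ∑ m, ‖c.dx m‖ ^ 2 := by positivity
  have h3 : 0 ≤ ∑ m, ‖c.dmu m‖ ^ 2 := by positivity
  unfold energy; linarith

/-- The candidate `a` is the weak limit of the candidates `c i` along `l`: derivatives converge
weakly and initial values converge. -/
structure WeakLimit {ι : Type*} (l : Filter ι) (c : ι → KernelCandidate σ ℓ T M P)
    (a : KernelCandidate σ ℓ T M P) : Prop where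
  dx : ∀ m, ∀ f : StrongDual ℝ (MaternRKHS σ ℓ T),
    Tendsto (fun i => f ((c i).dx m)) l (𝓝 (f (a.dx m)))
  dmu : ∀ m, ∀ f : StrongDual ℝ (MaternRKHS σ ℓ T),
    Tendsto (fun i => f ((c i).dmu m)) l (𝓝 (f (a.dmu m)))
  dy : ∀ m, ∀ f : StrongDual ℝ (MaternRKHS σ ℓ T),
    Tendsto (fun i => f ((c i).dy m)) l (𝓝 (f (a.dy m)))
  mu0 : Tendsto (fun i => (c i).mu0) l (𝓝 a.mu0)
  y0 : Tendsto (fun i => (c i).y0) l (𝓝 a.y0)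

/-- Candidates with bounded energy and initial values converge weakly along every ultrafilter. -/
theorem exists_weakLimit {ι : Type*} (U : Ultrafilter ι) {c : ι → KernelCandidate σ ℓ T M P}
    {A K : ℝ} (hA : ∀ᶠ i in (U : Filter ι), (c i).energy ≤ A)
    (hmu : ∀ i, ‖(c i).mu0‖ ≤ K) (hy : ∀ i, ‖(c i).y0‖ ≤ K) : ∃ a, WeakLimit U c a := by
  have h1 : ∀ m, ∃ a, ∀ f : StrongDual ℝ (MaternRKHS σ ℓ T),
      Tendsto (fun i => f ((c i).dx m)) U (𝓝 (f a)) := fun m =>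
    exists_weak_limit_of_ultrafilter U (R := √A) (hA.mono fun i hi =>
      ((c i).norm_dx_le m).trans (Real.sqrt_le_sqrt hi))
  have h2 : ∀ m, ∃ a, ∀ f : StrongDual ℝ (MaternRKHS σ ℓ T),
      Tendsto (fun i => f ((c i).dmu m)) U (𝓝 (f a)) := fun m =>
    exists_weak_limit_of_ultrafilter U (R := √A) (hA.mono fun i hi =>
      ((c i).norm_dmu_le m).trans (Real.sqrt_le_sqrt hi))
  have h3 : ∀ m, ∃ a, ∀ f : StrongDual ℝ (MaternRKHS σ ℓ T),
      Tendsto (fun i => f ((c i).dy m)) U (𝓝 (f a)) := fun m =>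
    exists_weak_limit_of_ultrafilter U (R := √A) (hA.mono fun i hi =>
      ((c i).norm_dy_le m).trans (Real.sqrt_le_sqrt hi))
  choose a1 h1 using h1
  choose a2 h2 using h2
  choose a3 h3 using h3
  have hb : ∀ {n : ℕ} (v : ι → Fin n → ℝ), (∀ i, ‖v i‖ ≤ K) → ∃ b, Tendsto v U (𝓝 b) :=
    fun {n} v hv => by
      obtain ⟨b, -, hb⟩ := (isCompact_closedBall (0 : Fin n → ℝ) K).ultrafilter_le_nhds (U.map v)
        (le_principal_iff.2 (Eventually.of_forall (f := (U : Filter ι)) fun i => by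
          simpa using hv i))
      exact ⟨b, hb⟩
  obtain ⟨b1, hb1⟩ := hb _ hmu
  obtain ⟨b2, hb2⟩ := hb _ hy
  exact ⟨⟨a1, a2, a3, b1, b2⟩, h1, h2, h3, hb1, hb2⟩

namespace WeakLimit

variable {ι : Type*} {l : Filter ι} {c : ι → KernelCandidate σ ℓ T M P}
  {a : KernelCandidate σ ℓ T M P}

/-- Each component of the velocity at `t` is a continuous functional of the candidate, so weak
convergence suffices. -/
theorem tendsto_vel (h : WeakLimit l c a) (t : Icc (0 : ℝ) T) :
    Tendsto (fun i => (c i).vel t) l (𝓝 (a.vel t)) := by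
  simp only [vel_apply]
  exact (tendsto_pi_nhds.2 fun m => h.dx m _).prodMk_nhds
    ((tendsto_pi_nhds.2 fun m => h.dmu m _).prodMk_nhds (tendsto_pi_nhds.2 fun m => h.dy m _))

theorem tendsto_traj (h : WeakLimit l c a) (x₀ : Fin M → ℝ) (t : Icc (0 : ℝ) T) :
    Tendsto (fun i => (c i).traj x₀ t) l (𝓝 (a.traj x₀ t)) := by
  simp only [traj_apply]
  exact (tendsto_pi_nhds.2 fun m => (h.dx m _).const_add _).prodMk_nhds
    ((tendsto_pi_nhds.2 fun m => (tendsto_pi_nhds.1 h.mu0 m).add (h.dmu m _)).prodMk_nhds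
      (tendsto_pi_nhds.2 fun m => (tendsto_pi_nhds.1 h.y0 m).add (h.dy m _)))

/-- The energy is weakly lower semicontinuous. -/
theorem energy_le [l.NeBot] (h : WeakLimit l c a) {A : ℝ} (hA : ∀ᶠ i in l, (c i).energy ≤ A) :
    a.energy ≤ A := by
  -- The right-hand side dominates its tangent at `b`, which is affine in `v` and so passes to weak
  -- limits; `self` records equality at `v = b`.
  have key : ∀ b v : MaternRKHS σ ℓ T, 2 * innerSL ℝ b v - ‖b‖ ^ 2 ≤ ‖v‖ ^ 2 := fun b v => by
    have := norm_sub_sq_real b v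
    rw [innerSL_apply_apply]
    nlinarith [sq_nonneg ‖b - v‖]
  have self : ∀ b : MaternRKHS σ ℓ T, 2 * innerSL ℝ b b - ‖b‖ ^ 2 = ‖b‖ ^ 2 := fun b => by
    rw [innerSL_apply_apply, real_inner_self_eq_norm_sq]; ring
  have lim := ((tendsto_finsetSum Finset.univ fun m _ =>
      ((h.dx m (innerSL ℝ (a.dx m))).const_mul 2).sub_const (‖a.dx m‖ ^ 2)).add
    (tendsto_finsetSum Finset.univ fun m _ =>
      ((h.dmu m (innerSL ℝ (a.dmu m))).const_mul 2).sub_const (‖a.dmu m‖ ^ 2))).add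
    (tendsto_finsetSum Finset.univ fun m _ =>
      ((h.dy m (innerSL ℝ (a.dy m))).const_mul 2).sub_const (‖a.dy m‖ ^ 2))
  simp only [self] at lim
  refine le_of_tendsto lim (hA.mono fun i hi => le_trans ?_ hi)
  exact add_le_add (add_le_add (Finset.sum_le_sum fun m _ => key _ _)
    (Finset.sum_le_sum fun m _ => key _ _)) (Finset.sum_le_sum fun m _ => key _ _)

end WeakLimit

theorem continuousOn_vel (c : KernelCandidate σ ℓ T M P) : ContinuousOn c.vel (Icc 0 T) :=
  (continuousOn_pi.2 fun m => continuousOn_maternEval (c.dx m)).prodMk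
    ((continuousOn_pi.2 fun m => continuousOn_maternEval (c.dmu m)).prodMk
      (continuousOn_pi.2 fun m => continuousOn_maternEval (c.dy m)))

theorem hasDerivWithinAt_add_integral_maternEval (h : MaternRKHS σ ℓ T) (a : ℝ) {t : ℝ}
    (ht : t ∈ Icc 0 T) :
    HasDerivWithinAt (fun s => a + ∫ τ in (0 : ℝ)..s, maternEval σ ℓ T h τ)
      (maternEval σ ℓ T h t) (Icc 0 T) t := by
  -- The fundamental theorem of calculus within `Icc 0 T`, endpoints included, finds its filter
  -- instance through this `Fact`.
  have : Fact (t ∈ Icc 0 T) := ⟨ht⟩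
  have hc := continuousOn_maternEval h
  exact (intervalIntegral.integral_hasDerivWithinAt_right (s := Icc 0 T) (t := Icc 0 T)
    (intervalIntegrable_maternEval h ht)
    (hc.stronglyMeasurableAtFilter_nhdsWithin measurableSet_Icc t) (hc t ht)).const_add a

theorem hasDerivWithinAt_traj (c : KernelCandidate σ ℓ T M P) (x₀ : Fin M → ℝ) {t : ℝ}
    (ht : t ∈ Icc 0 T) : HasDerivWithinAt (c.traj x₀) (c.vel t) (Icc 0 T) t :=
  (hasDerivWithinAt_pi.2 fun m => hasDerivWithinAt_add_integral_maternEval (c.dx m) _ ht).prodMk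
    ((hasDerivWithinAt_pi.2 fun m =>
      hasDerivWithinAt_add_integral_maternEval (c.dmu m) _ ht).prodMk
      (hasDerivWithinAt_pi.2 fun m => hasDerivWithinAt_add_integral_maternEval (c.dy m) _ ht))

theorem continuousOn_traj (c : KernelCandidate σ ℓ T M P) (x₀ : Fin M → ℝ) :
    ContinuousOn (c.traj x₀) (Icc 0 T) := fun _ ht =>
  (c.hasDerivWithinAt_traj x₀ ht).continuousWithinAt

end KernelCandidate

/-! ### The energy of a trajectory -/

section Energy

variable {σ ℓ T : ℝ} [hℓ : Fact (0 < ℓ)] {M P : ℕ}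

/-- An element of the RKHS is determined by its values, so the infimum has exactly one competitor.
-/
theorem maternNormSq_eq (h : MaternRKHS σ ℓ T) {f : ℝ → ℝ} (hf : ∀ t : Icc (0 : ℝ) T, h t = f t) :
    maternNormSq σ ℓ T f = ENNReal.ofReal (‖h‖ ^ 2) := by
  have e : ‖h‖ₑ ^ 2 = ENNReal.ofReal (‖h‖ ^ 2) := by
    rw [ENNReal.ofReal_pow (norm_nonneg _), ofReal_norm]
  rw [← e]
  refine le_antisymm (iInf₂_le h hf) (le_iInf₂ fun h' hf' => ?_)
  rw [show h' = h from RKHS.ext fun t => (hf' t).trans (hf t).symm]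

/-- The energy of a trajectory whose derivative is the velocity of a candidate. -/
theorem derivEnergy_eq (hT : 0 < T) (c : KernelCandidate σ ℓ T M P) {z : ℝ → DAEState M P}
    (hz : ∀ t ∈ Icc 0 T, HasDerivWithinAt z (c.vel t) (Icc 0 T) t) :
    derivEnergy σ ℓ T z = ENNReal.ofReal c.energy := by
  have hu : ∀ t : Icc (0 : ℝ) T, UniqueDiffWithinAt ℝ (Icc 0 T) (t : ℝ) :=
    fun t => uniqueDiffOn_Icc hT t t.2
  have h1 : ∀ m, maternNormSq σ ℓ T (derivWithin (fun s => (z s).1 m) (Icc 0 T)) =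
      ENNReal.ofReal (‖c.dx m‖ ^ 2) := fun m => maternNormSq_eq _ fun t => by
    have h := hasDerivWithinAt_pi.1 (hz t t.2).fst m
    rw [h.derivWithin (hu t)]
    exact (maternEval_coe _ _).symm
  have h2 : ∀ m, maternNormSq σ ℓ T (derivWithin (fun s => (z s).2.1 m) (Icc 0 T)) =
      ENNReal.ofReal (‖c.dmu m‖ ^ 2) := fun m => maternNormSq_eq _ fun t => by
    have h := hasDerivWithinAt_pi.1 (hz t t.2).snd.fst m
    rw [h.derivWithin (hu t)]
    exact (maternEval_coe _ _).symm
  have h3 : ∀ m, maternNormSq σ ℓ T (derivWithin (fun s => (z s).2.2 m) (Icc 0 T)) =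
      ENNReal.ofReal (‖c.dy m‖ ^ 2) := fun m => maternNormSq_eq _ fun t => by
    have h := hasDerivWithinAt_pi.1 (hz t t.2).snd.snd m
    rw [h.derivWithin (hu t)]
    exact (maternEval_coe _ _).symm
  simp only [derivEnergy, h1, h2, h3, KernelCandidate.energy]
  rw [ENNReal.ofReal_add (by positivity) (by positivity),
    ENNReal.ofReal_add (by positivity) (by positivity),
    ENNReal.ofReal_sum_of_nonneg fun _ _ => sq_nonneg _,
    ENNReal.ofReal_sum_of_nonneg fun _ _ => sq_nonneg _,
    ENNReal.ofReal_sum_of_nonneg fun _ _ => sq_nonneg _]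

end Energy

/-! ### Regular solutions have velocities in the RKHS -/

namespace DAE

variable {M P : ℕ} {D : DAE M P} {T K : ℝ} {x₀ : Fin M → ℝ} {z : ℝ → DAEState M P}

theorem LipschitzPrimitives.continuous_F (hD : D.LipschitzPrimitives) : Continuous D.F :=
  hD.F_lip.choose_spec.continuous

theorem LipschitzPrimitives.continuous_H (hD : D.LipschitzPrimitives) : Continuous D.H :=
  hD.H_lip.choose_spec.continuous

theorem LipschitzPrimitives.continuous_B (hD : D.LipschitzPrimitives) : Continuous D.B := by
  have := hD.G_lip.choose_spec.continuous
  unfold B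
  fun_prop

theorem jacY_mulVec (hD : D.LipschitzPrimitives) (w : DAEState M P) (v : Fin P → ℝ) :
    (D.jacY w).mulVec v = fderiv ℝ D.H w (0, 0, v) := by
  have h1 : HasFDerivAt (fun v : Fin P → ℝ => ((w.1, w.2.1, v) : DAEState M P))
      ((0 : (Fin P → ℝ) →L[ℝ] (Fin M → ℝ)).prod
        ((0 : (Fin P → ℝ) →L[ℝ] (Fin M → ℝ)).prod (ContinuousLinearMap.id ℝ (Fin P → ℝ)))) w.2.2 :=
    (hasFDerivAt_const _ _).prodMk ((hasFDerivAt_const _ _).prodMk (hasFDerivAt_id _))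
  have h2 : HasFDerivAt D.H (fderiv ℝ D.H w) (w.1, w.2.1, w.2.2) := (hD.H_diff w).hasFDerivAt
  have h3 := h2.comp w.2.2 h1
  rw [jacY, LinearMap.toMatrix'_mulVec]
  erw [h3.fderiv]
  simp

/-- The velocity that the system forces on a trajectory passing through `w`. -/
noncomputable def impliedVel (D : DAE M P) (w : DAEState M P) : DAEState M P :=
  (D.F w, D.B w, -((D.jacY w)⁻¹.mulVec (fderiv ℝ D.H w (D.F w, D.B w, 0))))

/-- The system gives no equation for `y'`. Differentiating `H (z t) = 0` gives a linear one whose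
matrix is the Jacobian in `y`, invertible by regularity. -/
theorem IsSolution.hasDerivWithinAt (hz : D.IsSolution T x₀ z) (hD : D.LipschitzPrimitives)
    (hT : 0 < T) (hreg : D.RegularAlong T z) {t : ℝ} (ht : t ∈ Icc 0 T) :
    HasDerivWithinAt z (D.impliedVel (z t)) (Icc 0 T) t := by
  have hy := (hz.diff_y t ht).hasDerivWithinAt
  set y' := derivWithin (fun s => (z s).2.2) (Icc 0 T) t
  have hz' : HasDerivWithinAt z (D.F (z t), D.B (z t), y') (Icc 0 T) t :=
    (hz.deriv_x t ht).prodMk ((hz.deriv_mu t ht).prodMk hy)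
  have h0 : fderiv ℝ D.H (z t) (D.F (z t), D.B (z t), y') = 0 := by
    have h1 := (hD.H_diff (z t)).hasFDerivAt.comp_hasDerivWithinAt t hz'
    have h2 : HasDerivWithinAt (D.H ∘ z) 0 (Icc 0 T) t :=
      (hasDerivWithinAt_const t _ 0).congr (fun s hs => hz.constraint s hs) (hz.constraint t ht)
    exact (uniqueDiffOn_Icc hT t ht).eq_deriv _ h1 h2
  have hsplit : ((D.F (z t), D.B (z t), y') : DAEState M P) =
      (D.F (z t), D.B (z t), 0) + (0, 0, y') := by simp
  rw [hsplit, map_add, ← jacY_mulVec hD] at h0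
  have hy' : y' = -((D.jacY (z t))⁻¹.mulVec
      (fderiv ℝ D.H (z t) (D.F (z t), D.B (z t), 0))) := by
    rw [eq_neg_of_add_eq_zero_left h0, Matrix.mulVec_neg, neg_neg, Matrix.mulVec_mulVec,
      Matrix.nonsing_inv_mul _ (isUnit_iff_ne_zero.2 (hreg.det_ne_zero t ht)), Matrix.one_mulVec]
  rw [impliedVel, ← hy']
  exact hz'

/-- A bootstrap: `z` is continuous because it is differentiable, so its velocity, a continuous
expression in `z` and the inverse Jacobian, is continuous. Hence `z` is Lipschitz, and then so is
every ingredient of the velocity; products are controlled by compactness of `[0, T]`. -/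
theorem IsSolution.isLipschitzOn_impliedVel (hz : D.IsSolution T x₀ z)
    (hD : D.LipschitzPrimitives) (hT : 0 < T) (hreg : D.RegularAlong T z) :
    IsLipschitzOn (fun t => D.impliedVel (z t)) (Icc 0 T) := by
  have hcomp : IsCompact (Icc 0 T) := isCompact_Icc
  have hderiv := fun t ht => hz.hasDerivWithinAt hD hT hreg (t := t) ht
  have hzc : ContinuousOn z (Icc 0 T) := fun t ht => (hderiv t ht).continuousWithinAt
  have hDH : Continuous (fderiv ℝ D.H) := hD.H_deriv_lip.choose_spec.continuous
  have hinv : ∀ i j, IsLipschitzOn (fun t => (D.jacY (z t))⁻¹ i j) (Icc 0 T) :=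
    fun i j => (hreg.inv_lip i j).1
  have hFc : ContinuousOn (fun t => D.F (z t)) (Icc 0 T) := hD.continuous_F.comp_continuousOn hzc
  have hBc : ContinuousOn (fun t => D.B (z t)) (Icc 0 T) := hD.continuous_B.comp_continuousOn hzc
  have hcont : ContinuousOn (fun t => D.impliedVel (z t)) (Icc 0 T) := by
    refine hFc.prodMk (hBc.prodMk (ContinuousOn.neg ?_))
    have h1 : ContinuousOn (fun t => fderiv ℝ D.H (z t) (D.F (z t), D.B (z t), 0)) (Icc 0 T) :=
      (hDH.comp_continuousOn hzc).clm_apply (hFc.prodMk (hBc.prodMk continuousOn_const))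
    refine continuousOn_pi.2 fun i => ?_
    simp only [Matrix.mulVec, dotProduct]
    exact continuousOn_finsetSum _ fun j _ =>
      (hinv i j).continuousOn.mul (continuousOn_pi.1 h1 j)
  have hzl : IsLipschitzOn z (Icc 0 T) := isLipschitzOn_Icc_of_hasDerivWithinAt hderiv hcont
  have hF := hD.F_lip.comp_isLipschitzOn hzl
  have hG := hD.G_lip.comp_isLipschitzOn hzl
  have hmu : IsLipschitzOn (fun t => (z t).2.1) (Icc 0 T) :=
    IsLipschitz.comp_isLipschitzOn
      ⟨1, LipschitzWith.prod_fst.comp LipschitzWith.prod_snd |>.weaken (by simp)⟩ hzl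
  have hB : IsLipschitzOn (fun t => D.B (z t)) (Icc 0 T) := by
    refine isLipschitzOn_pi.2 fun m => ?_
    have h1 := isLipschitzOn_pi.1 hmu m
    have h2 : IsLipschitzOn (fun _ : ℝ => D.r) (Icc 0 T) := ⟨0, (LipschitzWith.const _).lipschitzOnWith⟩
    exact (h2.mul hcomp h1).sub (h1.mul hcomp (isLipschitzOn_pi.1 hG m))
  refine hF.prodMk (hB.prodMk (IsLipschitzOn.neg ?_))
  have h0 : IsLipschitzOn (fun _ : ℝ => (0 : Fin P → ℝ)) (Icc 0 T) := ⟨0, (LipschitzWith.const _).lipschitzOnWith⟩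
  have h1 : IsLipschitzOn (fun t => fderiv ℝ D.H (z t) (D.F (z t), D.B (z t), 0)) (Icc 0 T) :=
    (hD.H_deriv_lip.comp_isLipschitzOn hzl).clm_apply hcomp (hF.prodMk (hB.prodMk h0))
  refine isLipschitzOn_pi.2 fun i => ?_
  simp only [Matrix.mulVec, dotProduct]
  exact IsLipschitzOn.sum _ fun j _ => (hinv i j).mul hcomp (isLipschitzOn_pi.1 h1 j)

/-- Solutions only depend on the values on `[0, T]`. -/
theorem mem_boundedSolutions_congr (hT : 0 < T) {w : ℝ → DAEState M P}
    (hz : z ∈ D.boundedSolutions T x₀ K) (h : EqOn w z (Icc 0 T)) :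
    w ∈ D.boundedSolutions T x₀ K := by
  obtain ⟨⟨h1, h2, h3, h4, h5⟩, h6, h7⟩ := hz
  have h0 := h (left_mem_Icc.2 hT.le)
  refine ⟨⟨by rw [h0, h1], fun t ht => ?_, fun t ht => ?_, ?_, fun t ht => by rw [h ht, h5 t ht]⟩,
    by rwa [h0], by rwa [h0]⟩
  · rw [h ht]
    exact (h2 t ht).congr (fun s hs => by rw [h hs]) (by rw [h ht])
  · rw [h ht]
    exact (h3 t ht).congr (fun s hs => by rw [h hs]) (by rw [h ht])
  · exact h4.congr fun s hs => by rw [h hs]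

end DAE

namespace KernelCandidate

variable {σ ℓ T K : ℝ} [hℓ : Fact (0 < ℓ)] {M P : ℕ} {D : DAE M P} {x₀ : Fin M → ℝ}

/-- The initial values are bounded by `K`, and the system holds at all points of `S`. -/
def FeasibleOn (D : DAE M P) (x₀ : Fin M → ℝ) (K : ℝ) (S : Set (Icc (0 : ℝ) T))
    (c : KernelCandidate σ ℓ T M P) : Prop :=
  ‖c.mu0‖ ≤ K ∧ ‖c.y0‖ ≤ K ∧ ∀ s ∈ S, D.residual (c.vel s) (c.traj x₀ s) = 0

theorem feasible_iff_feasibleOn_range {N : ℕ} (p : Fin N → Icc (0 : ℝ) T)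
    (c : KernelCandidate σ ℓ T M P) : Feasible D x₀ K p c ↔ FeasibleOn D x₀ K (range p) c := by
  simp [Feasible, FeasibleOn]

theorem FeasibleOn.mono {S S' : Set (Icc (0 : ℝ) T)} {c : KernelCandidate σ ℓ T M P}
    (h : FeasibleOn D x₀ K S' c) (hS : S ⊆ S') : FeasibleOn D x₀ K S c :=
  ⟨h.1, h.2.1, fun s hs => h.2.2 s (hS hs)⟩

/-- A candidate that satisfies the system on all of `[0, T]` gives a solution. -/
theorem FeasibleOn.traj_mem_boundedSolutions {c : KernelCandidate σ ℓ T M P}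
    (h : FeasibleOn D x₀ K univ c) : c.traj x₀ ∈ D.boundedSolutions T x₀ K := by
  have hres : ∀ t ∈ Icc 0 T, D.residual (c.vel t) (c.traj x₀ t) = 0 :=
    fun t ht => h.2.2 ⟨t, ht⟩ (mem_univ _)
  refine ⟨⟨?_, fun t ht => ?_, fun t ht => ?_, fun t ht => ?_, fun t ht => ?_⟩, ?_, ?_⟩
  · rw [traj_zero]
  · rw [← sub_eq_zero.1 (congrArg Prod.fst (hres t ht))]
    exact (c.hasDerivWithinAt_traj x₀ ht).fst
  · rw [← sub_eq_zero.1 (congrArg (fun w => w.2.1) (hres t ht))]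
    exact (c.hasDerivWithinAt_traj x₀ ht).snd.fst
  · exact HasFDerivWithinAt.differentiableWithinAt (c.hasDerivWithinAt_traj x₀ ht).snd.snd
  · exact congrArg (fun w => w.2.2) (hres t ht)
  · rw [traj_zero]; exact h.1
  · rw [traj_zero]; exact h.2.1

/-- A regular solution comes from a candidate that satisfies the system on all of `[0, T]` and has
the same energy. -/
theorem exists_feasibleOn_univ_of_regular (hT : 0 < T) (hσ : σ ≠ 0) (hD : D.LipschitzPrimitives)
    {z : ℝ → DAEState M P} (hz : z ∈ D.regularSolutions T x₀ K) :
    ∃ c : KernelCandidate σ ℓ T M P, FeasibleOn D x₀ K univ c ∧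
      derivEnergy σ ℓ T z = ENNReal.ofReal c.energy := by
  obtain ⟨⟨hsol, hmu, hy⟩, hreg⟩ := hz
  have hL := hsol.isLipschitzOn_impliedVel hD hT hreg
  have hcomp : ∀ {ψ : DAEState M P → ℝ}, LipschitzWith 1 ψ →
      ∃ h : MaternRKHS σ ℓ T, ∀ t : Icc (0 : ℝ) T, h t = ψ (D.impliedVel (z t)) := fun {ψ} hψ =>
    exists_maternRKHS_of_isLipschitzOn hσ (f := fun t => ψ (D.impliedVel (z t)))
      (IsLipschitz.comp_isLipschitzOn ⟨1, hψ⟩ hL)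
  choose dx hdx using fun m => hcomp (ψ := fun w => w.1 m)
    (((LipschitzWith.eval m).comp LipschitzWith.prod_fst).weaken (by simp))
  choose dmu hdmu using fun m => hcomp (ψ := fun w => w.2.1 m)
    (((LipschitzWith.eval m).comp (LipschitzWith.prod_fst.comp LipschitzWith.prod_snd)).weaken
      (by simp))
  choose dy hdy using fun m => hcomp (ψ := fun w => w.2.2 m)
    (((LipschitzWith.eval m).comp (LipschitzWith.prod_snd.comp LipschitzWith.prod_snd)).weaken
      (by simp))
  let c : KernelCandidate σ ℓ T M P := ⟨dx, dmu, dy, (z 0).2.1, (z 0).2.2⟩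
  have hvel : ∀ t ∈ Icc 0 T, c.vel t = D.impliedVel (z t) := fun t ht => by
    refine Prod.ext (funext fun m => ?_) (Prod.ext (funext fun m => ?_) (funext fun m => ?_))
    · exact (maternEval_of_mem _ ht).trans (hdx m ⟨t, ht⟩)
    · exact (maternEval_of_mem _ ht).trans (hdmu m ⟨t, ht⟩)
    · exact (maternEval_of_mem _ ht).trans (hdy m ⟨t, ht⟩)
  have hder : ∀ t ∈ Icc 0 T, HasDerivWithinAt z (c.vel t) (Icc 0 T) t := fun t ht => by
    rw [hvel t ht]; exact hsol.hasDerivWithinAt hD hT hreg ht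
  -- Both curves have the same derivative on `[0, T]` and the same value at `0`.
  have htraj : EqOn (c.traj x₀) z (Icc 0 T) := by
    have h0 : c.traj x₀ 0 = z 0 := by
      rw [traj_zero, ← hsol.init]
    refine fun t ht => eq_of_derivWithin_eq (a := 0) (b := T)
      (fun s hs => (c.hasDerivWithinAt_traj x₀ hs).differentiableWithinAt)
      (fun s hs => (hder s hs).differentiableWithinAt) (fun s hs => ?_) h0 t ht
    have hs' := Ico_subset_Icc_self hs
    have hu := uniqueDiffOn_Icc hT s hs'
    rw [(c.hasDerivWithinAt_traj x₀ hs').derivWithin hu, (hder s hs').derivWithin hu]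
  refine ⟨c, ⟨hmu, hy, fun s _ => ?_⟩, derivEnergy_eq hT c hder⟩
  rw [hvel s s.2, htraj s.2]
  simp [DAE.residual, DAE.impliedVel, hsol.constraint s s.2]

end KernelCandidate

/-! ### Minimal energy candidates -/

namespace KernelCandidate

variable {σ ℓ T K : ℝ} [hℓ : Fact (0 < ℓ)] {M P : ℕ} {D : DAE M P} {x₀ : Fin M → ℝ}

theorem continuous_residual (hD : D.LipschitzPrimitives) :
    Continuous fun q : DAEState M P × DAEState M P => D.residual q.1 q.2 := by
  have h1 := hD.continuous_F
  have h2 := hD.continuous_B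
  have h3 := hD.continuous_H
  unfold DAE.residual
  fun_prop

theorem WeakLimit.tendsto_residual {ι : Type*} {l : Filter ι} {c : ι → KernelCandidate σ ℓ T M P}
    {a : KernelCandidate σ ℓ T M P} (h : WeakLimit l c a) (hD : D.LipschitzPrimitives)
    (x₀ : Fin M → ℝ) (s : Icc (0 : ℝ) T) :
    Tendsto (fun i => D.residual ((c i).vel s) ((c i).traj x₀ s)) l
      (𝓝 (D.residual (a.vel s) (a.traj x₀ s))) :=
  ((continuous_residual hD).tendsto _).comp ((h.tendsto_vel s).prodMk_nhds (h.tendsto_traj x₀ s))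

theorem WeakLimit.feasibleOn {ι : Type*} {l : Filter ι} [l.NeBot]
    {c : ι → KernelCandidate σ ℓ T M P} {a : KernelCandidate σ ℓ T M P} (h : WeakLimit l c a)
    (hD : D.LipschitzPrimitives) (hmu : ∀ i, ‖(c i).mu0‖ ≤ K) (hy : ∀ i, ‖(c i).y0‖ ≤ K)
    {S : Set (Icc (0 : ℝ) T)}
    (hS : ∀ s ∈ S, ∀ᶠ i in l, D.residual ((c i).vel s) ((c i).traj x₀ s) = 0) :
    FeasibleOn D x₀ K S a :=
  ⟨le_of_tendsto h.mu0.norm (Eventually.of_forall hmu),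
    le_of_tendsto h.y0.norm (Eventually.of_forall hy), fun s hs =>
    tendsto_nhds_unique_of_eventuallyEq (h.tendsto_residual hD x₀ s) tendsto_const_nhds (hS s hs)⟩

/-- Velocity and trajectory of a single candidate are continuous on `[0, T]`, hence so is its
residual, which vanishes on a dense set. -/
theorem FeasibleOn.univ_of_dense {S : Set (Icc (0 : ℝ) T)} {c : KernelCandidate σ ℓ T M P}
    (h : FeasibleOn D x₀ K S c) (hD : D.LipschitzPrimitives) (hS : Dense S) :
    FeasibleOn D x₀ K univ c := by
  refine ⟨h.1, h.2.1, fun s _ => ?_⟩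
  have hc : Continuous fun s : Icc (0 : ℝ) T => D.residual (c.vel s) (c.traj x₀ s) :=
    (continuous_residual hD).comp
      ((continuousOn_iff_continuous_domRestrict.1 c.continuousOn_vel).prodMk
        (continuousOn_iff_continuous_domRestrict.1 (c.continuousOn_traj x₀)))
  exact congrFun (hc.ext_on hS continuous_const h.2.2) s

/-- If some candidate satisfies the system on `S`, there is one of minimal energy. -/
theorem exists_feasibleOn_minimal (hD : D.LipschitzPrimitives) {S : Set (Icc (0 : ℝ) T)}
    (hne : ∃ c : KernelCandidate σ ℓ T M P, FeasibleOn D x₀ K S c) :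
    ∃ c : KernelCandidate σ ℓ T M P, FeasibleOn D x₀ K S c ∧
      ∀ c' : KernelCandidate σ ℓ T M P, FeasibleOn D x₀ K S c' → c.energy ≤ c'.energy := by
  set E : Set ℝ := energy '' {c : KernelCandidate σ ℓ T M P | FeasibleOn D x₀ K S c}
  have hE : E.Nonempty := hne.elim fun c hc => ⟨_, c, hc, rfl⟩
  have hbd : BddBelow E := ⟨0, by rintro _ ⟨c, -, rfl⟩; exact c.energy_nonneg⟩
  obtain ⟨u, -, hu, huE⟩ := exists_seq_tendsto_sInf hE hbd
  choose c hc hcu using huE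
  have hlim : Tendsto (fun n => (c n).energy) (hyperfilter ℕ) (𝓝 (sInf E)) := by
    simp only [hcu]
    exact hu.mono_left Nat.hyperfilter_le_atTop
  have hle : ∀ ε > 0, ∀ᶠ n in (hyperfilter ℕ : Filter ℕ), (c n).energy ≤ sInf E + ε :=
    fun ε hε => (hlim.eventually_lt_const (by linarith)).mono fun n hn => hn.le
  obtain ⟨a, ha⟩ := exists_weakLimit (hyperfilter ℕ) (hle 1 one_pos) (fun n => (hc n).1)
    (fun n => (hc n).2.1)
  refine ⟨a, ha.feasibleOn hD (fun n => (hc n).1) (fun n => (hc n).2.1) fun s hs =>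
    Eventually.of_forall fun n => (hc n).2.2 s hs, fun c' hc' => ?_⟩
  exact (le_of_forall_pos_le_add fun ε hε => ha.energy_le (hle ε hε)).trans
    (csInf_le hbd ⟨c', hc', rfl⟩)

/-- Along every ultrafilter, ridgeless kernel solutions for a dense sequence of points have a weak
limit, which satisfies the system on all of `[0, T]`. -/
theorem exists_weakLimit_of_isRidgeless (hD : D.LipschitzPrimitives) {p : ℕ → Icc (0 : ℝ) T}
    (hp : DenseRange p) {b : KernelCandidate σ ℓ T M P} (hb : FeasibleOn D x₀ K univ b)
    {c : ℕ → KernelCandidate σ ℓ T M P}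
    (hc : ∀ N, (c N).IsRidgeless D x₀ K fun i : Fin N => p i) (U : Ultrafilter ℕ)
    (hU : (U : Filter ℕ) ≤ atTop) : ∃ a, WeakLimit U c a ∧ FeasibleOn D x₀ K univ a := by
  have hE : ∀ N, (c N).energy ≤ b.energy := fun N =>
    (hc N).2 b ((feasible_iff_feasibleOn_range _ b).2 (hb.mono (subset_univ _)))
  obtain ⟨a, ha⟩ := exists_weakLimit U (Eventually.of_forall hE) (fun N => (hc N).1.1)
    (fun N => (hc N).1.2.1)
  refine ⟨a, ha, (ha.feasibleOn hD (fun N => (hc N).1.1) (fun N => (hc N).1.2.1) ?_).univ_of_dense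
    hD hp⟩
  rintro _ ⟨i, rfl⟩
  -- The point `p i` is among the first `N` points exactly when `N > i`, so each equation holds from
  -- some `N` on.
  exact hU ((eventually_gt_atTop i).mono fun N hN => (hc N).1.2.2 ⟨i, hN⟩)

end KernelCandidate

/-! ### Density of independent uniform points -/

/-- Independent uniform points on `[0, T]` are almost surely dense. -/
theorem ae_denseRange_of_iIndepFun_isUniform {Ω : Type*} [MeasurableSpace Ω] (Pr : Measure Ω)
    [IsProbabilityMeasure Pr] {T : ℝ} (hT : 0 < T) (t : ℕ → Ω → Icc (0 : ℝ) T)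
    (hind : ProbabilityTheory.iIndepFun (fun i ω => (t i ω : ℝ)) Pr)
    (hunif : ∀ i, pdf.IsUniform (fun ω => (t i ω : ℝ)) (Icc 0 T) Pr volume) :
    ∀ᵐ ω ∂Pr, DenseRange fun i => t i ω := by
  have hvol : (volume (Icc 0 T) : ℝ≥0∞) = ENNReal.ofReal T := by simp
  have hv0 : (volume (Icc 0 T) : ℝ≥0∞) ≠ 0 := by simpa [hvol] using hT
  have hvt : (volume (Icc 0 T) : ℝ≥0∞) ≠ ∞ := by simp [hvol]
  have hit : ∀ O : Set ℝ, IsOpen O → O ⊆ Icc 0 T → O.Nonempty →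
      ∀ᵐ ω ∂Pr, ∃ i, (t i ω : ℝ) ∈ O := fun O hO hsub hne => by
    -- `q` is the probability that one sample misses `O`. By independence, the first `n` samples all
    -- miss it with probability `q ^ n`.
    set q := (volume (Icc 0 T ∩ Oᶜ) : ℝ≥0∞) / volume (Icc 0 T)
    have hq : q < 1 := by
      rw [ENNReal.div_lt_iff (Or.inl hv0) (Or.inl hvt), one_mul, ← sdiff_eq,
        measure_sdiff hsub hO.measurableSet.nullMeasurableSet (measure_ne_top_of_subset hsub hvt)]
      exact ENNReal.sub_lt_self hvt hv0 (hO.measure_pos volume hne).ne'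
    have hn : ∀ n : ℕ, Pr {ω | ¬ ∃ i, (t i ω : ℝ) ∈ O} ≤ q ^ n := fun n => by
      have h1 := hind.meas_biInter (S := Finset.range n)
        (s := fun i => (fun ω => (t i ω : ℝ)) ⁻¹' Oᶜ)
        fun i _ => ⟨Oᶜ, hO.measurableSet.compl, rfl⟩
      have h2 : ∀ i, Pr ((fun ω => (t i ω : ℝ)) ⁻¹' Oᶜ) = q := fun i =>
        (hunif i).measure_preimage hv0 hvt hO.measurableSet.compl
      simp only [h2, Finset.prod_const, Finset.card_range] at h1
      rw [← h1]
      refine measure_mono fun ω hω => mem_iInter₂.2 fun i _ hi => hω ⟨i, hi⟩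
    exact le_antisymm (ge_of_tendsto' (ENNReal.tendsto_pow_atTop_nhds_zero_of_lt_one hq) hn)
      zero_le
  have hall : ∀ᵐ ω ∂Pr, ∀ B ∈ TopologicalSpace.countableBasis ℝ, (B ∩ Ioo 0 T).Nonempty →
      ∃ i, (t i ω : ℝ) ∈ B ∩ Ioo 0 T := by
    refine (ae_ball_iff (TopologicalSpace.countable_countableBasis ℝ)).2 fun B hB => ?_
    by_cases hne : (B ∩ Ioo 0 T).Nonempty
    · filter_upwards [hit _ ((TopologicalSpace.isOpen_of_mem_countableBasis hB).inter isOpen_Ioo)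
        (inter_subset_right.trans Ioo_subset_Icc_self) hne] with ω hω _ using hω
    · exact ae_of_all _ fun ω h => absurd h hne
  filter_upwards [hall] with ω hω
  refine dense_iff_inter_open.2 fun V hV ⟨x, hx⟩ => ?_
  obtain ⟨W, hW, rfl⟩ := isOpen_induced_iff.1 hV
  -- A relatively open set around an endpoint still meets the open interval, so basic sets inside
  -- `(0, T)` suffice.
  have hx' : (x : ℝ) ∈ closure (Ioo 0 T) := by rw [closure_Ioo hT.ne]; exact x.2
  obtain ⟨y, hyW, hyT⟩ := mem_closure_iff.1 hx' W hW hx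
  obtain ⟨B, hB, hyB, hBW⟩ :=
    (TopologicalSpace.isBasis_countableBasis ℝ).exists_subset_of_mem_open hyW hW
  obtain ⟨i, hi⟩ := hω B hB ⟨y, hyB, hyT⟩
  exact ⟨t i ω, hBW hi.1, i, rfl⟩

/-! ### Existence and consistency of ridgeless kernel solutions -/

theorem mainTheorem3 {M P : ℕ} (D : DAE M P) (hr : 0 < D.r) (x₀ : Fin M → ℝ)
    (T K σ ℓ : ℝ) (hT : 0 < T) (hK : 0 < K) (hσ : 0 < σ) [Fact (0 < ℓ)]
    (hD : D.LipschitzPrimitives)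
    (hreg : ∀ z ∈ D.boundedSolutions T x₀ K, D.RegularAlong T z)
    (hne : (D.regularSolutions T x₀ K).Nonempty) :
    -- a minimum norm solution exists and has finite norm
    (∃ z ∈ D.regularSolutions T x₀ K, derivEnergy σ ℓ T z < ∞ ∧
      ∀ w ∈ D.regularSolutions T x₀ K, derivEnergy σ ℓ T z ≤ derivEnergy σ ℓ T w) ∧
    -- ridgeless kernel solutions exist for all collocation points
    (∀ (N : ℕ) (p : Fin N → Icc (0 : ℝ) T),
      ∃ c : KernelCandidate σ ℓ T M P, c.IsRidgeless D x₀ K p) ∧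
    -- consistency for i.i.d. uniform collocation points
    (∀ {Ω : Type*} [MeasurableSpace Ω] (Pr : Measure Ω) [IsProbabilityMeasure Pr]
      (t : ℕ → Ω → Icc (0 : ℝ) T),
      ProbabilityTheory.iIndepFun (fun i ω => (t i ω : ℝ)) Pr →
      (∀ i, pdf.IsUniform (fun ω => (t i ω : ℝ)) (Icc 0 T) Pr volume) →
      ∀ᵐ ω ∂Pr, ∀ c : ℕ → KernelCandidate σ ℓ T M P,
        (∀ N, (c N).IsRidgeless D x₀ K fun i : Fin N => t i ω) →
        -- the system is satisfied almost everywhere in the limit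
        (∀ᵐ s ∂(volume.restrict (Icc 0 T)),
          Tendsto (fun N => D.residual ((c N).vel s) ((c N).traj x₀ s)) atTop (𝓝 0)) ∧
        -- every pointwise limit of a subsequence is a solution
        (∀ (φ : ℕ → ℕ) (z : ℝ → DAEState M P), StrictMono φ →
          (∀ s ∈ Icc 0 T, Tendsto (fun n => (c (φ n)).traj x₀ s) atTop (𝓝 (z s))) →
          z ∈ D.regularSolutions T x₀ K) ∧
        -- the norms converge to the minimum
        Tendsto (fun N => ENNReal.ofReal (c N).energy) atTop
          (𝓝 (⨅ z ∈ D.regularSolutions T x₀ K, derivEnergy σ ℓ T z))) := by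
  have regular_of_feasible : ∀ c : KernelCandidate σ ℓ T M P,
      c.FeasibleOn D x₀ K univ → c.traj x₀ ∈ D.regularSolutions T x₀ K := fun c hc =>
    ⟨hc.traj_mem_boundedSolutions, hreg _ hc.traj_mem_boundedSolutions⟩
  have energy_traj : ∀ c : KernelCandidate σ ℓ T M P,
      derivEnergy σ ℓ T (c.traj x₀) = ENNReal.ofReal c.energy := fun c =>
    derivEnergy_eq hT c fun _ ht => c.hasDerivWithinAt_traj x₀ ht
  -- `b` has least energy among candidates exact on all of `[0, T]`. It realizes the minimum over
  -- regular solutions and competes in every collocation problem.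
  obtain ⟨b, hb, hbmin⟩ := KernelCandidate.exists_feasibleOn_minimal (σ := σ) (ℓ := ℓ) (x₀ := x₀)
    (K := K) (S := univ) hD
    (hne.elim fun z hz => (KernelCandidate.exists_feasibleOn_univ_of_regular (ℓ := ℓ) hT hσ.ne' hD
      hz).imp fun _ h => h.1)
  have hbz : ∀ w ∈ D.regularSolutions T x₀ K,
      ENNReal.ofReal b.energy ≤ derivEnergy σ ℓ T w := fun w hw => by
    obtain ⟨c, hc, hcw⟩ :=
      KernelCandidate.exists_feasibleOn_univ_of_regular (ℓ := ℓ) hT hσ.ne' hD hw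
    rw [hcw]
    exact ENNReal.ofReal_le_ofReal (hbmin c hc)
  refine ⟨⟨b.traj x₀, regular_of_feasible b hb, ?_, ?_⟩, fun N p => ?_, ?_⟩
  · rw [energy_traj]; exact ENNReal.ofReal_lt_top
  · rw [energy_traj]; exact hbz
  · obtain ⟨c, hc, hcmin⟩ := KernelCandidate.exists_feasibleOn_minimal (S := range p) hD
      ⟨b, hb.mono (subset_univ _)⟩
    simp only [← KernelCandidate.feasible_iff_feasibleOn_range] at hc hcmin
    exact ⟨c, hc, hcmin⟩
  intro Ω _ Pr _ t hind hunif
  filter_upwards [ae_denseRange_of_iIndepFun_isUniform Pr hT t hind hunif] with ω hω c hc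
  have hlim := KernelCandidate.exists_weakLimit_of_isRidgeless hD hω hb hc
  have hinf : ⨅ z ∈ D.regularSolutions T x₀ K, derivEnergy σ ℓ T z = ENNReal.ofReal b.energy :=
    le_antisymm (iInf₂_le_of_le _ (regular_of_feasible b hb) (energy_traj b).le) (le_iInf₂ hbz)
  refine ⟨?_, fun φ z hφ hz => ?_, ?_⟩
  -- The residual tends to zero at every `s`: along each ultrafilter finer than `atTop`, its limit
  -- is the residual of an exact weak limit.
  · refine ae_restrict_of_forall_mem measurableSet_Icc fun s hs => ?_
    refine tendsto_iff_ultrafilter _ _ _ |>.2 fun U hU => ?_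
    obtain ⟨a, ha, hafeas⟩ := hlim U hU
    have h := ha.tendsto_residual hD x₀ ⟨s, hs⟩
    rwa [hafeas.2.2 ⟨s, hs⟩ (mem_univ _)] at h
  -- An ultrafilter carried by the subsequence has an exact weak limit whose trajectory agrees with
  -- `z` on `[0, T]`. Outside that interval `z` is arbitrary.
  · obtain ⟨a, ha, hafeas⟩ := hlim ((hyperfilter ℕ).map φ)
      (hφ.tendsto_atTop.mono_left Nat.hyperfilter_le_atTop)
    have hzb : z ∈ D.boundedSolutions T x₀ K :=
      DAE.mem_boundedSolutions_congr hT hafeas.traj_mem_boundedSolutions fun s hs =>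
        tendsto_nhds_unique ((hz s hs).mono_left Nat.hyperfilter_le_atTop)
          (tendsto_map'_iff.1 (ha.tendsto_traj x₀ ⟨s, hs⟩))
    exact ⟨hzb, hreg z hzb⟩
  · rw [hinf]
    refine ENNReal.tendsto_ofReal (tendsto_order.2 ⟨fun e he => ?_, fun e he => ?_⟩)
    -- If the energies did not eventually exceed `e`, they would be at most `e` along some
    -- ultrafilter, and the weak limit would be an exact candidate of energy below that of `b`.
    · refine mem_iff_ultrafilter.2 fun U hU => ?_
      by_contra hcon
      obtain ⟨a, ha, hafeas⟩ := hlim U hU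
      exact he.not_ge ((hbmin a hafeas).trans (ha.energy_le
        ((Ultrafilter.eventually_not.2 hcon).mono fun N hN => not_lt.1 hN)))
    · refine Eventually.of_forall fun N => lt_of_le_of_lt ?_ he
      exact (hc N).2 b ((KernelCandidate.feasible_iff_feasibleOn_range _ b).2
        (hb.mono (subset_univ _)))
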